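/- Let $d,n\ge 0$, let $\|\cdot\|$ be any norm on $\mathbb R^n$ with dual norm $\|\cdot\|^*$, and let $U\subset\mathbb R^d$ be open and convex. An $\mathbb R^n$-valued $1$-covector is a bilinear map $\alpha:\mathbb R^d\times\mathbb R^n\to\mathbb R$, written $\langle\alpha;\tau,\theta\rangle$; its comass is $\|\alpha\|_c=\sup_{|\tau|\le 1}\|\alpha(\tau,\cdot)\|^*$. An $\mathbb R^n$-valued $1$-form in $U$ is a map $\omega$ from $U$ to the space $\Lambda^1(\mathbb R^d;\mathbb R^n)$ of these covectors, and $\|\omega\|_c=\sup_{x\in U}\|\omega(x)\|_c$. A $1$-current $T$ in $U$ with coefficients in $\mathbb R^n$ is a continuous linear functional on $C_c^\infty(U;\Lambda^1(\mathbb R^d;\mathbb R^n))$. Its mass is $\mathbb M(T)=\sup\{|T(\omega)|:\omega\in C_c^\infty(U;\Lambda^1(\mathbb R^d;\mathbb R^n)),\ \|\omega\|_c\le 1\}$, and its boundary is $\partial T(\eta)=T(d\eta)$ for $\eta\in C_c^\infty(U;\mathbb R^n)$, where $d\eta$ is taken componentwise. The support $\operatorname{spt}T$ is the complement in $U$ of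 the largest open subset of $U$ on which $T$ vanishes. A rectifiable $1$-current in $U$ with coefficients in $\mathbb Z^n$ is a $1$-current $T$ of finite mass such that $$T(\omega)=\int_\Sigma\langle\omega(x);\tau(x),\theta(x)\rangle\,d\mathscr H^1(x)\qquad\forall\,\omega\in C_c^\infty(U;\Lambda^1(\mathbb R^d;\mathbb R^n)),$$ where $\Sigma\subset U$ is countably $1$-rectifiable, $\tau$ is an $\mathscr H^1$-measurable unit vector field spanning the tangent line of $\Sigma$ at $\mathscr H^1$-a.e. point of $\Sigma$, and $\theta\in L^1_{\rm loc}(\Sigma;\mathbb Z^n)$ (locally in $U$); we write $T=[\![\Sigma,\tau,\theta]\!]$. A calibration for $T=[\![\Sigma,\tau,\theta]\!]$ is a smooth $\mathbb R^n$-valued $1$-form $\omega$ in $U$ such that 1. $\langle\omega(x);\tau(x),\theta(x)\rangle=\|\theta(x)\|$ for $\mathscr H^1$-a.e. $x\in\Sigma$; 2. $d\omega=0$ in $U$ (componentwise); 3. $\langle\omega(x);v,\eta\rangle\le\|\eta\|$ for all $x\in U$, all unit vectors $v\in\mathbb R^d$ and all $\eta\in\mathbb R^n$. **Theorem (Minimality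 of calibrated currents).** Let $T=[\![\Sigma,\tau,\theta]\!]$ be a rectifiable $1$-current in $U$ with coefficients in $\mathbb Z^n$, and let $\omega$ be a calibration for $T$. Then $\mathbb M(T)\le\mathbb M(T')$ for every rectifiable $1$-current $T'$ in $U$ with coefficients in $\mathbb Z^n$ such that $\partial T'=\partial T$ and such that the closure in $\mathbb R^d$ of $\operatorname{spt}(T'-T)$ is contained in $U$. (The last condition holds automatically if $U=\mathbb R^d$, or if $T$ and $T'$ have compact support in $U$.) -/

import Mathlib

open MeasureTheory Set TopologicalSpace
open scoped Distributions ENNReal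

noncomputable section

namespace ZnCurrent

/-- The ambient space `ℝ^d`, and also the space of coefficients `ℝ^n`, as Euclidean spaces. -/
abbrev Euc (k : ℕ) : Type := EuclideanSpace ℝ (Fin k)

/-- `Λ¹(ℝ^d; ℝ^n)`: the `ℝ^n`-valued `1`-covectors in `ℝ^d`, i.e. the bilinear maps
`α : ℝ^d × ℝ^n → ℝ`, written in curried form. -/
abbrev Covector (d n : ℕ) : Type := Euc d →L[ℝ] (Euc n →L[ℝ] ℝ)

/-- The `j`-th component `α_j = α(·, e_j)` of an `ℝ^n`-valued `1`-covector. -/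
def Covector.component {d n : ℕ} (α : Covector d n) (j : Fin n) : Euc d →L[ℝ] ℝ :=
  ContinuousLinearMap.flip α (EuclideanSpace.single j (1 : ℝ))

/-- The dual norm `‖ℓ‖* = sup {|ℓ v| : ‖v‖ ≤ 1}`, with respect to the norm `N` on `ℝ^n`. -/
def dualNorm {n : ℕ} (N : Seminorm ℝ (Euc n)) (l : Euc n →L[ℝ] ℝ) : ℝ≥0∞ :=
  ⨆ (v : Euc n) (_ : N v ≤ 1), ENNReal.ofReal |l v|

/-- The comass norm `‖α‖_c = sup {‖α(τ, ·)‖* : |τ| ≤ 1}` of an `ℝ^n`-valued `1`-covector. -/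
def comass {d n : ℕ} (N : Seminorm ℝ (Euc n)) (α : Covector d n) : ℝ≥0∞ :=
  ⨆ (τ : Euc d) (_ : ‖τ‖ ≤ 1), dualNorm N (α τ)

/-- The comass norm `‖ω‖_c = sup_{x ∈ U} ‖ω(x)‖_c` of an `ℝ^n`-valued `1`-form in `U`. -/
def formComass {d n : ℕ} (U : Opens (Euc d)) (N : Seminorm ℝ (Euc n))
    (ω : Euc d → Covector d n) : ℝ≥0∞ :=
  ⨆ x ∈ U, comass N (ω x)

/-- The linear map that sends `A : ℝ^d → ℝ^n` to the covector `(τ, θ) ↦ ⟪A τ, θ⟫`. -/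
def toCovector (d n : ℕ) : (Euc d →L[ℝ] Euc n) →L[ℝ] Covector d n :=
  ContinuousLinearMap.compL ℝ (Euc d) (Euc n) (Euc n →L[ℝ] ℝ)
    (isBoundedBilinearMap_inner (𝕜 := ℝ) (E := Euc n)).toContinuousLinearMap

theorem toCovector_apply {d n : ℕ} (A : Euc d →L[ℝ] Euc n) (τ : Euc d) (θ : Euc n) :
    toCovector d n A τ θ = inner ℝ (A τ) θ := rfl

/-- The exterior derivative `C_c^∞(U; ℝ^n) → C_c^∞(U; Λ¹(ℝ^d; ℝ^n))`. Componentwise it is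
`(dη)_j = d(η_j)`, i.e. `⟨dη(x); τ, θ⟩ = ⟪Dη(x) τ, θ⟫`. -/
def extDerivZeroForm (d n : ℕ) (U : Opens (Euc d)) :
    𝓓(U, Euc n) →L[ℝ] 𝓓(U, Covector d n) :=
  (TestFunction.postcompCLM (𝕜 := ℝ) (F := Euc d →L[ℝ] Euc n) (F' := Covector d n)
    (toCovector d n)).comp (TestFunction.fderivCLM ℝ ⊤ ⊤)

theorem extDerivZeroForm_apply {d n : ℕ} {U : Opens (Euc d)} (η : 𝓓(U, Euc n))
    (x τ : Euc d) (θ : Euc n) :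
    extDerivZeroForm d n U η x τ θ = inner ℝ (fderiv ℝ η x τ) θ := by
  simp [extDerivZeroForm, toCovector_apply]

/-- The components of `dη` are the differentials of the components of `η`. -/
theorem extDerivZeroForm_component {d n : ℕ} {U : Opens (Euc d)} (η : 𝓓(U, Euc n))
    (x : Euc d) (j : Fin n) :
    (extDerivZeroForm d n U η x).component j = fderiv ℝ (fun y => η y j) x := by
  have h : HasFDerivAt η (fderiv ℝ η x) x :=
    ((η.contDiff.differentiable (by simp)) x).hasFDerivAt
  have h2 := hasFDerivWithinAt_euclidean.1 (h.hasFDerivWithinAt (s := univ)) j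
  rw [hasFDerivWithinAt_univ] at h2
  rw [h2.fderiv]
  ext τ
  simp [Covector.component, extDerivZeroForm_apply, EuclideanSpace.inner_single_right]

/-- `1`-currents in `U` with coefficients in `ℝ^n`: continuous linear functionals on
`C_c^∞(U; Λ¹(ℝ^d; ℝ^n))`. -/
abbrev Current (d n : ℕ) (U : Opens (Euc d)) : Type := 𝓓(U, Covector d n) →L[ℝ] ℝ

/-- The boundary `∂T(η) = T(dη)`, for `η ∈ C_c^∞(U; ℝ^n)`. -/
def boundary {d n : ℕ} {U : Opens (Euc d)} (T : Current d n U) : 𝓓(U, Euc n) →L[ℝ] ℝ :=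
  T.comp (extDerivZeroForm d n U)

/-- The mass `M(T) = sup {|T(ω)| : ‖ω‖_c ≤ 1}` (over test forms `ω`) with respect to the norm `N`
on the coefficients. -/
def mass {d n : ℕ} {U : Opens (Euc d)} (N : Seminorm ℝ (Euc n)) (T : Current d n U) : ℝ≥0∞ :=
  ⨆ (ω : 𝓓(U, Covector d n)) (_ : formComass U N ω ≤ 1), ENNReal.ofReal |T ω|

/-- `S` is a (countably) `1`-rectifiable set: it is `ℋ¹`-measurable, and it is covered, up to an
`ℋ¹`-null set, by the images of countably many curves of class `C¹`. -/
def IsRectifiableSet {d : ℕ} (S : Set (Euc d)) : Prop :=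
  NullMeasurableSet S (μH[1] : Measure (Euc d)) ∧
    ∃ γ : ℕ → ℝ → Euc d, (∀ i, ContDiff ℝ 1 (γ i)) ∧
      (μH[1] : Measure (Euc d)) (S \ ⋃ i, range (γ i)) = 0

/-- `ξ` is an orientation of the rectifiable set `S`: an (`ℋ¹`-measurable) field of unit vectors
such that `ξ(x)` spans the tangent line `Tan(S, x)` for `ℋ¹`-a.e. `x ∈ S`. The tangent line of a
rectifiable set is determined, up to an `ℋ¹`-null set of points, by the property that for every
`C¹` curve `γ` it contains the tangent of `γ` at `ℋ¹`-a.e. point of `S` that lies on `γ`. -/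
def IsOrientation {d : ℕ} (S : Set (Euc d)) (ξ : Euc d → Euc d) : Prop :=
  AEStronglyMeasurable ξ ((μH[1] : Measure (Euc d)).restrict S) ∧
    (∀ᵐ x ∂(μH[1] : Measure (Euc d)).restrict S, ‖ξ x‖ = 1) ∧
    ∀ γ : ℝ → Euc d, ContDiff ℝ 1 γ →
      ∀ᵐ x ∂(μH[1] : Measure (Euc d)).restrict S,
        ∀ t : ℝ, γ t = x → deriv γ t ∈ Submodule.span ℝ {ξ x}

/-- An integer vector, as a vector of `ℝ^n`. -/
def intVec {n : ℕ} (z : Fin n → ℤ) : Euc n := WithLp.toLp 2 (fun j => (z j : ℝ))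

/-- The current `T` is `⟦S, ξ, θ⟧`: it has the integral representation
`T(ω) = ∫_S ⟨ω(x); ξ(x), θ(x)⟩ dℋ¹(x)`, where `S ⊆ U` is `1`-rectifiable, `ξ` is an orientation
of `S`, and `θ ∈ L¹_loc(S; ℤ^n)`, local integrability being understood in `U`. -/
structure IsRepresentedBy {d n : ℕ} {U : Opens (Euc d)} (T : Current d n U)
    (S : Set (Euc d)) (ξ : Euc d → Euc d) (θ : Euc d → Fin n → ℤ) : Prop where
  subset : S ⊆ U
  rectifiable : IsRectifiableSet S
  orientation : IsOrientation S ξ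
  locallyIntegrable : LocallyIntegrableOn (fun x => intVec (θ x)) (U : Set (Euc d))
    ((μH[1] : Measure (Euc d)).restrict S)
  apply_eq : ∀ ω : 𝓓(U, Covector d n),
    T ω = ∫ x in S, ω x (ξ x) (intVec (θ x)) ∂(μH[1] : Measure (Euc d))

/-- `T` is a rectifiable `1`-current in `U` with coefficients in `ℤ^n`: it has finite mass, and it
is of the form `⟦S, ξ, θ⟧`. -/
def IsRectifiableCurrent {d n : ℕ} {U : Opens (Euc d)} (N : Seminorm ℝ (Euc n))
    (T : Current d n U) : Prop :=
  mass N T < ∞ ∧ ∃ S ξ θ, IsRepresentedBy T S ξ θ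

/-- The smooth `ℝ^n`-valued `1`-form `ω` in `U` is a calibration for the rectifiable current
`⟦S, ξ, θ⟧`. Values of `ω` outside `U` are irrelevant. -/
structure IsCalibration {d n : ℕ} (U : Opens (Euc d)) (N : Seminorm ℝ (Euc n))
    (ω : Euc d → Covector d n) (S : Set (Euc d)) (ξ : Euc d → Euc d)
    (θ : Euc d → Fin n → ℤ) : Prop where
  smooth : ContDiffOn ℝ ((⊤ : ℕ∞) : WithTop ℕ∞) ω (U : Set (Euc d))
  calibrates : ∀ᵐ x ∂(μH[1] : Measure (Euc d)).restrict S,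
    ω x (ξ x) (intVec (θ x)) = N (intVec (θ x))
  closed : ∀ j : Fin n, ∀ x ∈ U,
    extDeriv (fun y => ContinuousAlternatingMap.ofSubsingleton ℝ (Euc d) ℝ (0 : Fin 1)
      ((ω y).component j)) x = 0
  comass_le : ∀ x ∈ U, ∀ τ : Euc d, ‖τ‖ = 1 → ∀ v : Euc n, ω x τ v ≤ N v

end ZnCurrent

end

/-!
A calibrated current `T = ⟦S, ξ, θ⟧` is compared with a competitor `T'` by testing both against
truncations `χ ω` of the calibration `ω`, where `χ` is a cutoff function with compact support
in `U`. If `χ = 1` on the support of a test form `α` of comass at most `1`, then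
`|T(α)| ≤ ∫_S χ N(θ) = T(χ ω)` (`ZnCurrent.IsCalibration.abs_apply_le`), while `T'(χ ω) ≤ M(T')`,
since `χ ω` has comass at most `1`. So everything depends on `R = T' - T`, a cycle of finite mass:
it has to be shown that `R(χ ω)` is small for suitable `χ`.

As `U` is convex and `ω` is closed, `ω = dΦ`; the comass bound on `ω` makes `Φ` grow at most
linearly, `|⟨Φ(x), v⟩| ≤ |x - x₀| N(v)` (`ZnCurrent.IsCalibration.exists_primitive`). Now
`R(χ ω) = R(d(χ Φ)) - R(dχ ⊗ Φ) = - R(dχ ⊗ Φ)`. The support of `R` is closed in `ℝ^d` but need not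
be compact, so `dχ` cannot be made to vanish near all of it. Instead `χ = ψ ρ`, where `ρ` is a
logarithmic cutoff, with `|dρ(x)| |x - x₀| ≤ ε` (`exists_contDiff_logarithmic_cutoff`), and `ψ` is
equal to `1` near the compact part of the support of `R` that lies in the support of `ρ`. Then
`ρ dψ ⊗ Φ` is supported away from the support of `R`, and `ψ dρ ⊗ Φ` has comass at most `ε`, so
that `|R(χ ω)| ≤ ε M(R)` (`ZnCurrent.exists_cutoff_apply_add_apply_eq_zero`). Letting `ε → 0` gives
`|T(α)| ≤ M(T')` for every `α`.
-/

open Filter Distribution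
open scoped Topology

/-! ### Cutoff functions -/

section Cutoff

open scoped ContDiff Manifold

variable {E F : Type*} [NormedAddCommGroup E] [NormedSpace ℝ E]
  [NormedAddCommGroup F] [NormedSpace ℝ F]

theorem exists_contDiff_cutoff [FiniteDimensional ℝ E] {K V : Set E} (hK : IsCompact K)
    (hV : IsOpen V) (hKV : K ⊆ V) :
    ∃ ψ : E → ℝ, ContDiff ℝ ∞ ψ ∧ HasCompactSupport ψ ∧ tsupport ψ ⊆ V ∧
      (∀ x, ψ x ∈ Icc (0 : ℝ) 1) ∧ ∀ᶠ x in 𝓝ˢ K, ψ x = 1 := by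
  obtain ⟨L, hL, hKL, hLV⟩ := exists_compact_between hK hV hKV
  obtain ⟨f, hf0, hf1, hf⟩ := exists_contMDiffMap_zero_one_nhds_of_isClosed (n := ⊤) 𝓘(ℝ, E)
    (isOpen_interior (s := L)).isClosed_compl hK.isClosed
    (disjoint_left.2 fun x hx hxK => hx (hKL hxK))
  have hsub : tsupport f ⊆ L := by
    intro x hx
    by_contra hxL
    have h0 : ∀ᶠ y in 𝓝 x, f y = 0 :=
      hf0.filter_mono (nhds_le_nhdsSet
        (show x ∈ (interior L)ᶜ from fun h => hxL (interior_subset h)))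
    exact (notMem_tsupport_iff_eventuallyEq.2 h0) hx
  exact ⟨f, f.contMDiff.contDiff, hL.of_isClosed_subset (isClosed_tsupport _) hsub,
    hsub.trans hLV, hf, hf1⟩

theorem ContDiffOn.contDiff_smul_of_tsupport_subset {U : Set E} (hU : IsOpen U) {χ : E → ℝ}
    (hχ : ContDiff ℝ ∞ χ) (hχU : tsupport χ ⊆ U) {f : E → F} (hf : ContDiffOn ℝ ∞ f U) :
    ContDiff ℝ ∞ fun x => χ x • f x := by
  rw [contDiff_iff_contDiffAt]
  intro x
  by_cases hx : x ∈ U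
  · exact hχ.contDiffAt.smul (hf.contDiffAt (hU.mem_nhds hx))
  · have h0 : (fun y => χ y • f y) =ᶠ[𝓝 x] fun _ => 0 := by
      filter_upwards [notMem_tsupport_iff_eventuallyEq.1 fun h => hx (hχU h)] with y hy
      simp [hy]
    exact contDiffAt_const.congr_of_eventuallyEq h0

/-- The product `χ f`, as a test function in `U`, of a smooth cutoff function `χ` with compact
support in `U` and of a function `f` which is smooth in `U` (and arbitrary outside `U`). -/
noncomputable def cutoffSMul {U : Opens E} (χ : E → ℝ) (f : E → F) (hχ : ContDiff ℝ ∞ χ)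
    (hχc : HasCompactSupport χ) (hχU : tsupport χ ⊆ U) (hf : ContDiffOn ℝ ∞ f U) :
    𝓓(U, F) where
  toFun x := χ x • f x
  contDiff' := hf.contDiff_smul_of_tsupport_subset U.isOpen hχ hχU
  hasCompactSupport' := hχc.smul_right
  tsupport_subset' := (tsupport_smul_subset_left χ f).trans hχU

/-- There are cutoff functions, equal to `1` on arbitrarily large balls, whose gradient at `x` is
arbitrarily small compared with `1 / ‖x - x₀‖`. In particular the product of the gradient with a
function of linear growth is uniformly small. -/
theorem exists_contDiff_logarithmic_cutoff {E : Type*} [NormedAddCommGroup E]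
    [InnerProductSpace ℝ E] [FiniteDimensional ℝ E] (x₀ : E) (r : ℝ) {ε : ℝ} (hε : 0 < ε) :
    ∃ ρ : E → ℝ, ContDiff ℝ ∞ ρ ∧ HasCompactSupport ρ ∧ (∀ x, ρ x ∈ Icc (0 : ℝ) 1) ∧
      (∀ x ∈ Metric.closedBall x₀ r, ρ x = 1) ∧
      ∀ x, ‖fderiv ℝ ρ x‖ * ‖x - x₀‖ ≤ ε := by
  let g : ContDiffBump (0 : ℝ) := ⟨1, 2, one_pos, one_lt_two⟩
  have hg : ContDiff ℝ ∞ g := g.contDiff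
  obtain ⟨C, hC⟩ := (g.hasCompactSupport.fderiv ℝ).exists_bound_of_continuous
    (hg.continuous_fderiv (by simp))
  have hC0 : 0 ≤ C := (norm_nonneg _).trans (hC 0)
  have hlog : 0 ≤ Real.log (1 + r ^ 2) := Real.log_nonneg (by nlinarith [sq_nonneg r])
  -- `δ` is small enough for the ball of radius `r`, and for the bound on the gradient.
  obtain ⟨δ, hδ, hδr, hδε⟩ : ∃ δ : ℝ, 0 < δ ∧ δ * Real.log (1 + r ^ 2) ≤ 1 ∧ C * (δ * 2) ≤ ε := by
    refine ⟨min (1 / (1 + Real.log (1 + r ^ 2))) (ε / (2 * (C + 1))), by positivity, ?_, ?_⟩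
    · calc _ ≤ 1 / (1 + Real.log (1 + r ^ 2)) * Real.log (1 + r ^ 2) := by
            gcongr; exact min_le_left _ _
        _ ≤ 1 := by rw [one_div_mul_eq_div, div_le_one (by positivity)]; linarith
    · calc _ ≤ C * (ε / (2 * (C + 1)) * 2) := by gcongr; exact min_le_right _ _
        _ = ε * (C / (C + 1)) := by field_simp
        _ ≤ ε * 1 := by gcongr; rw [div_le_one (by positivity)]; linarith
        _ = ε := mul_one ε
  have hpos : ∀ x, 0 < 1 + ‖x - x₀‖ ^ 2 := fun x => by positivity
  let h : E → ℝ := fun x => δ * Real.log (1 + ‖x - x₀‖ ^ 2)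
  have hh : ContDiff ℝ ∞ h :=
    contDiff_const.mul ((contDiff_const.add ((contDiff_id.sub contDiff_const).norm_sq ℝ)).log
      fun x => (hpos x).ne')
  refine ⟨g ∘ h, hg.comp hh, ?_, fun x => ⟨g.nonneg, g.le_one⟩, ?_, ?_⟩
  · refine HasCompactSupport.intro (isCompact_closedBall x₀ (Real.exp (2 / δ))) fun x hx => ?_
    rw [mem_closedBall_iff_norm, not_le] at hx
    apply g.zero_of_le_dist
    have h1 : Real.exp (2 / δ) ≤ 1 + ‖x - x₀‖ ^ 2 := by nlinarith [sq_nonneg (‖x - x₀‖ - 1)]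
    have h2 : 2 / δ ≤ Real.log (1 + ‖x - x₀‖ ^ 2) := (Real.le_log_iff_exp_le (hpos x)).2 h1
    rw [Real.dist_0_eq_abs]
    rw [div_le_iff₀' hδ] at h2
    exact h2.trans (le_abs_self _)
  · intro x hx
    rw [mem_closedBall_iff_norm] at hx
    apply g.one_of_mem_closedBall
    have h0 : 0 ≤ Real.log (1 + ‖x - x₀‖ ^ 2) :=
      Real.log_nonneg (by nlinarith [sq_nonneg ‖x - x₀‖])
    have h1 : Real.log (1 + ‖x - x₀‖ ^ 2) ≤ Real.log (1 + r ^ 2) :=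
      Real.log_le_log (hpos x) (by gcongr)
    rw [mem_closedBall_zero_iff, Real.norm_of_nonneg (by positivity)]
    exact (mul_le_mul_of_nonneg_left h1 hδ.le).trans hδr
  · intro x
    have hsq : HasFDerivAt (fun y : E => ‖y - x₀‖ ^ 2) (2 • (innerSL ℝ (x - x₀))) x := by
      simpa using! ((hasFDerivAt_id x).sub_const x₀).norm_sq
    have hd : HasFDerivAt h (δ • ((1 + ‖x - x₀‖ ^ 2)⁻¹ • (2 • (innerSL ℝ (x - x₀))))) x :=
      ((hsq.const_add 1).log (hpos x).ne').const_mul δ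
    have hcomp := ((hg.differentiable (by simp)) (h x)).hasFDerivAt.comp x hd
    rw [hcomp.fderiv]
    calc _ ≤ ‖fderiv ℝ g (h x)‖ * ‖δ • ((1 + ‖x - x₀‖ ^ 2)⁻¹ • (2 • (innerSL ℝ (x - x₀))))‖
            * ‖x - x₀‖ := by gcongr; exact ContinuousLinearMap.opNorm_comp_le _ _
      _ = ‖fderiv ℝ g (h x)‖ * (δ * 2 * (‖x - x₀‖ ^ 2 / (1 + ‖x - x₀‖ ^ 2))) := by
            rw [norm_smul, norm_smul, two_smul, ← two_smul ℝ, norm_smul, innerSL_apply_norm,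
              Real.norm_of_nonneg hδ.le, Real.norm_of_nonneg (inv_nonneg.2 (hpos x).le),
              Real.norm_of_nonneg zero_le_two]
            field_simp
      _ ≤ C * (δ * 2 * 1) := by
            gcongr
            · exact hC _
            · rw [div_le_one (hpos x)]; linarith
      _ ≤ ε := by rwa [mul_one]

end Cutoff

/-! ### Distributions vanish off their support -/

section Vanishing

variable {E F : Type*} [NormedAddCommGroup E] [NormedSpace ℝ E] [FiniteDimensional ℝ E]
  [NormedAddCommGroup F] [NormedSpace ℝ F] {U : Opens E} {R : 𝓓(U, F) →L[ℝ] ℝ}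

theorem Distribution.IsVanishingOn.union_of_isOpen {V W : Set E} (hV : IsOpen V) (hW : IsOpen W)
    (hRV : IsVanishingOn R V) (hRW : IsVanishingOn R W) : IsVanishingOn R (V ∪ W) := by
  intro u hu
  have hK : IsCompact (tsupport u \ W) := u.hasCompactSupport.isCompact.diff hW
  obtain ⟨ψ, hψ, hψc, hψV, -, hψ1⟩ := exists_contDiff_cutoff hK hV
    fun x hx => (hu hx.1).resolve_right hx.2
  -- `u = ψ u + (1 - ψ) u`, where `ψ u` is supported in `V` and `(1 - ψ) u` in `W`.
  let v : 𝓓(U, F) :=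
    ⟨fun x => ψ x • u x, hψ.smul u.contDiff, hψc.smul_right,
      (tsupport_smul_subset_right ψ u).trans u.tsupport_subset⟩
  have hv : R v = 0 := hRV v ((tsupport_smul_subset_left ψ u).trans hψV)
  have hw : R (u - v) = 0 := by
    refine hRW _ fun x hx => ?_
    by_contra hxW
    refine (notMem_tsupport_iff_eventuallyEq.2 ?_) hx
    by_cases hxu : x ∈ tsupport u
    · filter_upwards [hψ1.filter_mono
        (nhds_le_nhdsSet (show x ∈ tsupport u \ W from ⟨hxu, hxW⟩))] with y hy
      change u y - ψ y • u y = 0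
      simp [hy]
    · filter_upwards [notMem_tsupport_iff_eventuallyEq.1 hxu] with y hy
      change u y - ψ y • u y = 0
      simp [hy]
  rw [map_sub, hv, sub_zero] at hw
  exact hw

/-- A distribution vanishes on the union of all open sets on which it vanishes: by compactness of
the support of a test function, finitely many of them suffice. -/
theorem isVanishingOn_compl_dsupport : IsVanishingOn R (dsupport R)ᶜ := by
  intro u hu
  obtain ⟨V, -, huV, hRV⟩ : ∃ V : Set E, IsOpen V ∧ tsupport u ⊆ V ∧ IsVanishingOn R V := by
    refine u.hasCompactSupport.isCompact.induction_on
      (p := fun s => ∃ V : Set E, IsOpen V ∧ s ⊆ V ∧ IsVanishingOn R V) ?_ ?_ ?_ ?_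
    · refine ⟨∅, isOpen_empty, subset_rfl, fun v hv => ?_⟩
      have : v = 0 := by
        ext x
        exact congr_fun (tsupport_eq_empty_iff.1 (subset_empty_iff.1 hv)) x
      rw [this, map_zero]
    · rintro s t hst ⟨V, hV, htV, hRV⟩
      exact ⟨V, hV, hst.trans htV, hRV⟩
    · rintro s t ⟨V, hV, hsV, hRV⟩ ⟨W, hW, htW, hRW⟩
      exact ⟨V ∪ W, hV.union hW, union_subset_union hsV htW, hRV.union_of_isOpen hV hW hRW⟩
    · intro x hx
      obtain ⟨V, hRV, hV, hxV⟩ := (notMem_dsupport_iff x).1 (hu hx)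
      exact ⟨V, mem_nhdsWithin_of_mem_nhds (hV.mem_nhds hxV), V, hV, subset_rfl, hRV⟩
  exact hRV u huV

end Vanishing

namespace ZnCurrent

variable {d n : ℕ} {U : Opens (Euc d)} {N : Seminorm ℝ (Euc n)}

/-! ### Comass and mass -/

theorem abs_apply_le_of_forall_le {E F : Type*} [NormedAddCommGroup E] [NormedSpace ℝ E]
    [NormedAddCommGroup F] [NormedSpace ℝ F] {p : Seminorm ℝ F} {α : E →L[ℝ] F →L[ℝ] ℝ}
    (hα : ∀ τ, ‖τ‖ = 1 → ∀ v, α τ v ≤ p v) (τ : E) (v : F) : |α τ v| ≤ ‖τ‖ * p v := by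
  rcases eq_or_ne τ 0 with rfl | hτ
  · simp
  have hτ' : 0 < ‖τ‖ := norm_pos_iff.2 hτ
  have key : ∀ w, α τ w ≤ ‖τ‖ * p w := by
    intro w
    have := hα (‖τ‖⁻¹ • τ) (by rw [norm_smul, norm_inv, norm_norm, inv_mul_cancel₀ hτ'.ne']) w
    rw [map_smul, smul_apply, smul_eq_mul, inv_mul_le_iff₀ hτ'] at this
    exact this
  rw [abs_le']
  refine ⟨key v, ?_⟩
  simpa using key (-v)

theorem formComass_le_one_of_forall_le {ω : Euc d → Covector d n}
    (h : ∀ x ∈ U, ∀ τ v, |ω x τ v| ≤ ‖τ‖ * N v) : formComass U N ω ≤ 1 := by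
  refine iSup₂_le fun x hx => iSup₂_le fun τ hτ => iSup₂_le fun v hv => ?_
  rw [ENNReal.ofReal_le_one]
  calc _ ≤ ‖τ‖ * N v := h x hx τ v
    _ ≤ 1 * 1 := by gcongr
    _ = 1 := one_mul 1

theorem abs_apply_le_of_formComass_le_one (hN : ∀ v, N v = 0 → v = 0)
    {ω : Euc d → Covector d n} (h : formComass U N ω ≤ 1) {x : Euc d} (hx : x ∈ U)
    (τ : Euc d) (v : Euc n) : |ω x τ v| ≤ ‖τ‖ * N v := by
  have key : ∀ σ : Euc d, ‖σ‖ ≤ 1 → ∀ w : Euc n, N w ≤ 1 → |ω x σ w| ≤ 1 := by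
    intro σ hσ w hw
    rw [← ENNReal.ofReal_le_one]
    calc _ ≤ dualNorm N (ω x σ) :=
          le_iSup₂_of_le (f := fun w (_ : N w ≤ 1) => ENNReal.ofReal |ω x σ w|) w hw le_rfl
      _ ≤ comass N (ω x) :=
          le_iSup₂_of_le (f := fun σ (_ : ‖σ‖ ≤ 1) => dualNorm N (ω x σ)) σ hσ le_rfl
      _ ≤ formComass U N ω :=
          le_iSup₂_of_le (f := fun y (_ : y ∈ U) => comass N (ω y)) x hx le_rfl
      _ ≤ 1 := h
  rcases eq_or_ne v 0 with rfl | hv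
  · simp
  have hNv : 0 < N v := lt_of_le_of_ne (apply_nonneg N v) fun h0 => hv (hN v h0.symm)
  have hunit : N ((N v)⁻¹ • v) ≤ 1 := by
    rw [map_smul_eq_mul, Real.norm_of_nonneg (inv_nonneg.2 hNv.le), inv_mul_cancel₀ hNv.ne']
  have hle : ∀ σ : Euc d, ‖σ‖ ≤ 1 → |ω x σ v| ≤ N v := by
    intro σ hσ
    have := key σ hσ _ hunit
    rwa [map_smul, smul_eq_mul, abs_mul, abs_of_pos (inv_pos.2 hNv), inv_mul_le_iff₀ hNv,
      mul_one] at this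
  rcases eq_or_ne τ 0 with rfl | hτ
  · simp
  have hτ' : 0 < ‖τ‖ := norm_pos_iff.2 hτ
  have := hle (‖τ‖⁻¹ • τ) (by rw [norm_smul, norm_inv, norm_norm, inv_mul_cancel₀ hτ'.ne'])
  rwa [map_smul, smul_apply, smul_eq_mul, abs_mul,
    abs_of_pos (inv_pos.2 hτ'), inv_mul_le_iff₀ hτ'] at this

/-- The mass bounds `T(β)` for forms `β` of comass at most `c`, by homogeneity. -/
theorem abs_apply_le_mul_mass {T : Current d n U} (hT : mass N T < ∞) {β : 𝓓(U, Covector d n)}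
    {c : ℝ} (hc : 0 < c) (hβ : ∀ x ∈ U, ∀ τ v, |β x τ v| ≤ c * (‖τ‖ * N v)) :
    |T β| ≤ c * (mass N T).toReal := by
  have hle : formComass U N (c⁻¹ • β : 𝓓(U, Covector d n)) ≤ 1 := by
    refine formComass_le_one_of_forall_le fun x hx τ v => ?_
    change |c⁻¹ * β x τ v| ≤ _
    rw [abs_mul, abs_of_pos (inv_pos.2 hc), inv_mul_le_iff₀ hc]
    exact hβ x hx τ v
  have h1 : ENNReal.ofReal |T (c⁻¹ • β)| ≤ mass N T :=
    le_iSup₂_of_le (f := fun (ω : 𝓓(U, Covector d n)) (_ : formComass U N ω ≤ 1) =>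
      ENNReal.ofReal |T ω|) _ hle le_rfl
  rw [ENNReal.ofReal_le_iff_le_toReal hT.ne, map_smul, smul_eq_mul, abs_mul,
    abs_of_pos (inv_pos.2 hc), inv_mul_le_iff₀ hc] at h1
  exact h1

/-! ### Primitives of calibrations -/

/-- By the Poincaré lemma a calibration in a convex open set has a primitive. As the comass of the
calibration is at most `1`, the primitive is `1`-Lipschitz for the dual norm on the coefficients;
normalized to vanish at `x₀`, it grows at most linearly. -/
theorem IsCalibration.exists_primitive (hU : Convex ℝ (U : Set (Euc d)))
    {ω : Euc d → Covector d n} {S : Set (Euc d)} {ξ : Euc d → Euc d} {θ : Euc d → Fin n → ℤ}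
    (hω : IsCalibration U N ω S ξ θ) {x₀ : Euc d} (hx₀ : x₀ ∈ U) :
    ∃ Φ : Euc d → Euc n →L[ℝ] ℝ, ContDiffOn ℝ ((⊤ : ℕ∞) : WithTop ℕ∞) Φ U ∧
      (∀ x ∈ U, HasFDerivAt Φ (ω x) x) ∧
      ∀ x ∈ U, ∀ v, |Φ x v| ≤ ‖x - x₀‖ * N v := by
  have hdiff : DifferentiableOn ℝ ω U := hω.smooth.differentiableOn (by simp)
  -- `dω = 0` says that the derivative of each component of `ω` is a symmetric bilinear form.
  have hsymm : ∀ a ∈ (U : Set (Euc d)), ∀ x y, fderiv ℝ ω a x y = fderiv ℝ ω a y x := by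
    intro a ha x y
    have hda : HasFDerivAt ω (fderiv ℝ ω a) a :=
      (hdiff.differentiableAt (U.isOpen.mem_nhds ha)).hasFDerivAt
    have hj : ∀ j : Fin n, fderiv ℝ ω a x y (EuclideanSpace.single j (1 : ℝ)) =
        fderiv ℝ ω a y x (EuclideanSpace.single j (1 : ℝ)) := by
      intro j
      have h1 := congrArg (fun α => α ![x, y]) (hω.closed j a ha)
      have hd : DifferentiableAt ℝ (fun y => ContinuousAlternatingMap.ofSubsingleton ℝ (Euc d) ℝ
          (0 : Fin 1) ((ω y).component j)) a :=
        (ContinuousAlternatingMap.ofSubsingletonLIE (𝕜 := ℝ) (E := Euc d) (F := ℝ)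
          (0 : Fin 1)).comp_differentiableAt_iff.2
          ((differentiableAt_const (ContinuousLinearMap.apply ℝ ℝ
            (EuclideanSpace.single j (1 : ℝ)))).clm_comp hda.differentiableAt)
      simp only [extDeriv_apply hd] at h1
      have e : ∀ z w, fderiv ℝ (fun y => ω y z (EuclideanSpace.single j (1 : ℝ))) a w =
          fderiv ℝ ω a w z (EuclideanSpace.single j (1 : ℝ)) := fun z w => by
        rw [((hda.clm_apply (hasFDerivAt_const z a)).clm_apply (hasFDerivAt_const _ a)).fderiv]
        simp
      rw [← e, ← e]
      simp [Fin.removeNth_apply, Covector.component] at h1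
      linarith
    have : (fderiv ℝ ω a x y).toLinearMap = (fderiv ℝ ω a y x).toLinearMap := by
      refine (EuclideanSpace.basisFun (Fin n) ℝ).toBasis.ext fun j => ?_
      simpa using hj j
    exact ContinuousLinearMap.coe_injective this
  obtain ⟨Ψ, hΨ⟩ := hU.exists_forall_hasFDerivAt_of_fderiv_symmetric U.isOpen hdiff hsymm
  have hΦ : ∀ x ∈ U, HasFDerivAt (fun y => Ψ y - Ψ x₀) (ω x) x := fun x hx =>
    (hΨ x hx).sub_const _
  refine ⟨fun y => Ψ y - Ψ x₀, ?_, hΦ, fun x hx v => ?_⟩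
  · rw [contDiffOn_infty_iff_fderiv_of_isOpen U.isOpen]
    exact ⟨fun x hx => (hΦ x hx).differentiableAt.differentiableWithinAt,
      hω.smooth.congr fun x hx => (hΦ x hx).fderiv⟩
  · have hv : ∀ y ∈ (U : Set (Euc d)), HasFDerivWithinAt (fun z => Ψ z v)
        ((ContinuousLinearMap.apply ℝ ℝ v).comp (ω y)) U y := fun y hy =>
      ((ContinuousLinearMap.apply ℝ ℝ v).hasFDerivAt.comp y (hΨ y hy)).hasFDerivWithinAt
    have hbound : ∀ y ∈ (U : Set (Euc d)),
        ‖(ContinuousLinearMap.apply ℝ ℝ v).comp (ω y)‖ ≤ N v := fun y hy =>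
      ContinuousLinearMap.opNorm_le_bound _ (apply_nonneg N v) fun τ => by
        rw [mul_comm]
        exact abs_apply_le_of_forall_le (hω.comass_le y hy) τ v
    have := hU.norm_image_sub_le_of_norm_hasFDerivWithin_le hv hbound hx₀ hx
    rw [mul_comm]
    exact this

/-! ### Cycles almost annihilate truncated exact forms -/

/-- The Riesz representation of linear forms on `ℝ^n`, as a continuous linear map. -/
noncomputable def rieszVec (n : ℕ) : (Euc n →L[ℝ] ℝ) →L[ℝ] Euc n :=
  LinearMap.toContinuousLinearMap
    { toFun := (InnerProductSpace.toDual ℝ (Euc n)).symm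
      map_add' := map_add _
      map_smul' := fun c l => by simp }

theorem inner_rieszVec (l : Euc n →L[ℝ] ℝ) (v : Euc n) : inner ℝ (rieszVec n l) v = l v :=
  InnerProductSpace.toDual_symm_apply

theorem extDerivZeroForm_cutoffSMul {χ : Euc d → ℝ} {Φ : Euc d → Euc n →L[ℝ] ℝ}
    {ω : Euc d → Covector d n} (hχ : ContDiff ℝ ((⊤ : ℕ∞) : WithTop ℕ∞) χ)
    (hχc : HasCompactSupport χ) (hχU : tsupport χ ⊆ U)
    (hΦ : ContDiffOn ℝ ((⊤ : ℕ∞) : WithTop ℕ∞) (fun x => rieszVec n (Φ x)) U)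
    {x : Euc d} (hΦω : HasFDerivAt Φ (ω x) x) (τ : Euc d) (v : Euc n) :
    extDerivZeroForm d n U (cutoffSMul χ (fun x => rieszVec n (Φ x)) hχ hχc hχU hΦ) x τ v =
      χ x * ω x τ v + fderiv ℝ χ x τ * Φ x v := by
  rw [extDerivZeroForm_apply]
  have h1 : HasFDerivAt (fun y => rieszVec n (Φ y)) ((rieszVec n).comp (ω x)) x :=
    HasFDerivAt.comp (F := Euc n →L[ℝ] ℝ) x (rieszVec n).hasFDerivAt hΦω
  have h2 := ((hχ.differentiable (by simp)) x).hasFDerivAt.smul h1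
  have h3 : fderiv ℝ (cutoffSMul χ (fun x => rieszVec n (Φ x)) hχ hχc hχU hΦ) x = _ := h2.fderiv
  rw [h3]
  simp [inner_add_left, real_inner_smul_left, inner_rieszVec]

/-- Let `ω = dΦ`, where `Φ` grows at most linearly, and let `R` be a cycle whose support is closed
in `ℝ^d`. Then there are cutoff functions `χ`, equal to `1` on a given compact set, such that
`R(χ ω) + R(β) = 0` with `β` of arbitrarily small comass.

Indeed `χ = ψ ρ`, with `ρ` a logarithmic cutoff and `ψ` equal to `1` near the part of the support
of `R` where `ρ` lives. As `d(χ Φ) = χ ω + ψ dρ ⊗ Φ + ρ dψ ⊗ Φ`, the cycle `R` annihilates the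
left-hand side, and also the last summand, whose support does not meet that of `R`. The form
`β = ψ dρ ⊗ Φ` is small by the choice of `ρ`. -/
theorem exists_cutoff_apply_add_apply_eq_zero {R : Current d n U} (hR : boundary R = 0)
    (hsupp : dsupport R ⊆ (U : Set (Euc d))) {ω : Euc d → Covector d n}
    (hω : ContDiffOn ℝ ((⊤ : ℕ∞) : WithTop ℕ∞) ω U) {Φ : Euc d → Euc n →L[ℝ] ℝ}
    (hΦ : ContDiffOn ℝ ((⊤ : ℕ∞) : WithTop ℕ∞) Φ U) (hΦω : ∀ x ∈ U, HasFDerivAt Φ (ω x) x)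
    {x₀ : Euc d} (hΦN : ∀ x ∈ U, ∀ v, |Φ x v| ≤ ‖x - x₀‖ * N v)
    {K : Set (Euc d)} (hK : IsCompact K) (hKU : K ⊆ U) {ε : ℝ} (hε : 0 < ε) :
    ∃ (χ : Euc d → ℝ) (hχ : ContDiff ℝ ((⊤ : ℕ∞) : WithTop ℕ∞) χ) (hχc : HasCompactSupport χ)
      (hχU : tsupport χ ⊆ U) (β : 𝓓(U, Covector d n)),
      (∀ x, χ x ∈ Icc (0 : ℝ) 1) ∧ (∀ x ∈ K, χ x = 1) ∧
      (∀ x ∈ U, ∀ τ v, |β x τ v| ≤ ε * (‖τ‖ * N v)) ∧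
      R (cutoffSMul χ ω hχ hχc hχU hω) + R β = 0 := by
  obtain ⟨r, hr⟩ := hK.isBounded.subset_closedBall x₀
  obtain ⟨ρ, hρ, hρc, hρ01, hρ1, hρε⟩ := exists_contDiff_logarithmic_cutoff x₀ r hε
  have hK' : IsCompact (K ∪ tsupport ρ ∩ dsupport R) :=
    hK.union (hρc.isCompact.inter_right isClosed_dsupport)
  obtain ⟨ψ, hψ, hψc, hψU, hψ01, hψ1⟩ := exists_contDiff_cutoff hK' U.isOpen
    (union_subset hKU (inter_subset_right.trans hsupp))
  have hχ : ContDiff ℝ ((⊤ : ℕ∞) : WithTop ℕ∞) fun x => ψ x * ρ x := hψ.mul hρ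
  have hχc : HasCompactSupport fun x => ψ x * ρ x := hψc.mul_right
  have hχU : tsupport (fun x => ψ x * ρ x) ⊆ U := (tsupport_mul_subset_left (f := ψ)).trans hψU
  have hdρ : ContDiff ℝ ((⊤ : ℕ∞) : WithTop ℕ∞) (fderiv ℝ ρ) := hρ.fderiv_right (by simp)
  have hβ : ContDiffOn ℝ ((⊤ : ℕ∞) : WithTop ℕ∞)
      (fun x => ((fderiv ℝ ρ x).smulRight (Φ x) : Covector d n)) U := hdρ.contDiffOn.smulRight hΦ
  let β : 𝓓(U, Covector d n) := cutoffSMul ψ _ hψ hψc hψU hβ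
  have hη : ContDiffOn ℝ ((⊤ : ℕ∞) : WithTop ℕ∞) (fun x => rieszVec n (Φ x)) U :=
    (rieszVec n).contDiff.comp_contDiffOn hΦ
  let η : 𝓓(U, Euc n) := cutoffSMul _ _ hχ hχc hχU hη
  have hβ_apply : ∀ x τ v, β x τ v = ψ x * (fderiv ℝ ρ x τ * Φ x v) := fun x τ v => rfl
  refine ⟨_, hχ, hχc, hχU, β, fun x => ⟨mul_nonneg (hψ01 x).1 (hρ01 x).1,
    mul_le_one₀ (hψ01 x).2 (hρ01 x).1 (hρ01 x).2⟩, fun x hx => ?_, fun x hx τ v => ?_, ?_⟩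
  · rw [hρ1 x (hr hx), hψ1.self_of_nhdsSet x (Or.inl hx), one_mul]
  · have hNv : 0 ≤ N v := apply_nonneg N v
    rw [hβ_apply, abs_mul, abs_mul, abs_of_nonneg (hψ01 x).1]
    calc _ ≤ 1 * ((‖fderiv ℝ ρ x‖ * ‖τ‖) * (‖x - x₀‖ * N v)) := by
          gcongr
          · exact (hψ01 x).2
          · exact (fderiv ℝ ρ x).le_opNorm τ
          · exact hΦN x hx v
      _ = (‖fderiv ℝ ρ x‖ * ‖x - x₀‖) * (‖τ‖ * N v) := by ring
      _ ≤ ε * (‖τ‖ * N v) := by gcongr; exact hρε x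
  · -- The form `γ = d(χ Φ) - χ ω - β` is equal to `ρ dψ ⊗ Φ` in `U`.
    let χω : 𝓓(U, Covector d n) := cutoffSMul _ ω hχ hχc hχU hω
    have hγ : ∀ x ∈ U, ∀ τ v, (extDerivZeroForm d n U η - χω - β) x τ v =
        ρ x * (fderiv ℝ ψ x τ * Φ x v) := by
      intro x hx τ v
      have hd : fderiv ℝ (fun x => ψ x * ρ x) x τ =
          ψ x * fderiv ℝ ρ x τ + ρ x * fderiv ℝ ψ x τ := by
        rw [fderiv_fun_mul ((hψ.differentiable (by simp)) x) ((hρ.differentiable (by simp)) x)]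
        simp
      change extDerivZeroForm d n U η x τ v - ψ x * ρ x * ω x τ v - β x τ v = _
      rw [extDerivZeroForm_cutoffSMul hχ hχc hχU hη (hΦω x hx), hβ_apply, hd]
      ring
    have hγ0 : R (extDerivZeroForm d n U η - χω - β) = 0 := by
      refine isVanishingOn_compl_dsupport _ fun x hx hxR => ?_
      refine (notMem_tsupport_iff_eventuallyEq.2 ?_) hx
      have hxU : ∀ᶠ y in 𝓝 x, y ∈ U := U.isOpen.mem_nhds (hsupp hxR)
      -- Near a point of the support of `R`, either `ψ = 1` or `ρ = 0`.
      by_cases hxρ : x ∈ tsupport ρ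
      · have hψx : ∀ᶠ y in 𝓝 x, ψ y = 1 := hψ1.filter_mono
          (nhds_le_nhdsSet (show x ∈ K ∪ tsupport ρ ∩ dsupport R from Or.inr ⟨hxρ, hxR⟩))
        filter_upwards [hxU, eventually_eventually_nhds.2 hψx] with y hyU hy
        have hdψ : fderiv ℝ ψ y = 0 := by
          rw [Filter.EventuallyEq.fderiv_eq (f := fun _ => (1 : ℝ)) hy, fderiv_const_apply]
        ext τ v
        rw [hγ y hyU, hdψ]
        simp
      · filter_upwards [hxU, notMem_tsupport_iff_eventuallyEq.1 hxρ] with y hyU hy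
        ext τ v
        rw [hγ y hyU, hy]
        simp
    have hη0 : R (extDerivZeroForm d n U η) = 0 := DFunLike.congr_fun hR η
    rw [map_sub, map_sub, hη0] at hγ0
    linarith

/-! ### Comparison on the calibrated current -/

theorem continuous_seminorm (N : Seminorm ℝ (Euc n)) : Continuous N := by
  rw [← continuousOn_univ]
  exact N.convexOn.continuousOn isOpen_univ

theorem IsRepresentedBy.integrable_cutoff {T : Current d n U} {S : Set (Euc d)}
    {ξ : Euc d → Euc d} {θ : Euc d → Fin n → ℤ} (hT : IsRepresentedBy T S ξ θ) {χ : Euc d → ℝ}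
    (hχ : Continuous χ) (hχc : HasCompactSupport χ) (hχU : tsupport χ ⊆ U) :
    Integrable (fun x => χ x * N (intVec (θ x))) ((μH[1] : Measure (Euc d)).restrict S) := by
  have hθ := hT.locallyIntegrable.integrableOn_compact_subset hχU hχc.isCompact
  obtain ⟨C, -, hC⟩ := Seminorm.bound_of_continuous_normedSpace N (continuous_seminorm N)
  obtain ⟨B, hB⟩ := hχc.exists_bound_of_continuous hχ
  have hNθ : IntegrableOn (fun x => N (intVec (θ x))) (tsupport χ)
      ((μH[1] : Measure (Euc d)).restrict S) := by
    refine (hθ.norm.const_mul C).mono'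
      ((continuous_seminorm N).comp_aestronglyMeasurable hθ.aestronglyMeasurable) ?_
    refine Eventually.of_forall fun x => ?_
    rw [Real.norm_of_nonneg (apply_nonneg N _)]
    exact hC _
  have h := hNθ.bdd_mul (c := B) hχ.aestronglyMeasurable (Eventually.of_forall hB)
  refine (integrableOn_iff_integrable_of_support_subset fun x hx => ?_).1 h
  refine subset_tsupport χ fun h0 => hx ?_
  simp [h0]

/-- On the calibrated current no test form of comass at most `1` does better than a truncation
`χ ω` of the calibration, provided that `χ = 1` on the support of the test form: `χ ω` pairs with
`T` to give `∫ χ N(θ)`. -/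
theorem IsCalibration.abs_apply_le {T : Current d n U} {S : Set (Euc d)}
    {ξ : Euc d → Euc d} {θ : Euc d → Fin n → ℤ} (hT : IsRepresentedBy T S ξ θ)
    {ω : Euc d → Covector d n} (hω : IsCalibration U N ω S ξ θ) {α : 𝓓(U, Covector d n)}
    (hα : ∀ x ∈ U, ∀ τ v, |α x τ v| ≤ ‖τ‖ * N v) {χ : Euc d → ℝ}
    (hχ : ContDiff ℝ ((⊤ : ℕ∞) : WithTop ℕ∞) χ) (hχc : HasCompactSupport χ)
    (hχU : tsupport χ ⊆ U) (hχ0 : ∀ x, 0 ≤ χ x) (hχ1 : ∀ x ∈ tsupport α, χ x = 1) :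
    |T α| ≤ T (cutoffSMul χ ω hχ hχc hχU hω.smooth) := by
  have hTχ : T (cutoffSMul χ ω hχ hχc hχU hω.smooth) =
      ∫ x in S, χ x * N (intVec (θ x)) ∂(μH[1] : Measure (Euc d)) := by
    rw [hT.apply_eq]
    refine integral_congr_ae ?_
    filter_upwards [hω.calibrates] with x hx
    rw [← hx]
    rfl
  rw [hTχ, hT.apply_eq, ← Real.norm_eq_abs]
  refine norm_integral_le_of_norm_le (hT.integrable_cutoff hχ.continuous hχc hχU) ?_
  filter_upwards [hT.orientation.2.1] with x hξ
  by_cases hx : x ∈ tsupport α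
  · have := hα x (α.tsupport_subset hx) (ξ x) (intVec (θ x))
    rwa [hξ, one_mul, ← one_mul (N _), ← hχ1 x hx] at this
  · rw [image_eq_zero_of_notMem_tsupport hx]
    simpa using mul_nonneg (hχ0 x) (apply_nonneg N (intVec (θ x)))

end ZnCurrent

theorem mainTheorem4 {d n : ℕ} (U : TopologicalSpace.Opens (ZnCurrent.Euc d))
    (hU : Convex ℝ (U : Set (ZnCurrent.Euc d)))
    (N : Seminorm ℝ (ZnCurrent.Euc n)) (hN : ∀ v, N v = 0 → v = 0)
    (T : ZnCurrent.Current d n U) (hmass : ZnCurrent.mass N T < ∞)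
    (S : Set (ZnCurrent.Euc d)) (ξ : ZnCurrent.Euc d → ZnCurrent.Euc d)
    (θ : ZnCurrent.Euc d → Fin n → ℤ) (hT : ZnCurrent.IsRepresentedBy T S ξ θ)
    (ω : ZnCurrent.Euc d → ZnCurrent.Covector d n)
    (hω : ZnCurrent.IsCalibration U N ω S ξ θ)
    (T' : ZnCurrent.Current d n U) (hT' : ZnCurrent.IsRectifiableCurrent N T')
    (hbdry : ZnCurrent.boundary T' = ZnCurrent.boundary T)
    (hsupp : Distribution.dsupport (T' - T) ⊆ (U : Set (ZnCurrent.Euc d))) :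
    ZnCurrent.mass N T ≤ ZnCurrent.mass N T' := by
  open ZnCurrent in
  refine iSup₂_le fun α hα => ?_
  rw [ENNReal.ofReal_le_iff_le_toReal hT'.1.ne]
  -- A point of the support of `α` serves as base point of the primitive: `U` may be empty.
  rcases (tsupport α).eq_empty_or_nonempty with hempty | ⟨x₀, hx₀⟩
  · have : α = 0 := by
      ext1 x
      exact congr_fun (tsupport_eq_empty_iff.1 hempty) x
    simp [this]
  obtain ⟨Φ, hΦ, hΦω, hΦN⟩ := hω.exists_primitive hU (α.tsupport_subset hx₀)
  have hR : boundary (T' - T) = 0 := by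
    ext1 η
    exact sub_eq_zero.2 (DFunLike.congr_fun hbdry η)
  have hsmall : ∀ ε : ℝ, 0 < ε →
      |T α| ≤ (mass N T').toReal + ε * ((mass N T').toReal + (mass N T).toReal) := by
    intro ε hε
    obtain ⟨χ, hχ, hχc, hχU, β, hχ01, hχ1, hβ, hRχ⟩ := exists_cutoff_apply_add_apply_eq_zero hR
      hsupp hω.smooth hΦ hΦω hΦN α.hasCompactSupport.isCompact α.tsupport_subset hε
    have h1 := hω.abs_apply_le hT (fun x hx => abs_apply_le_of_formComass_le_one hN hα hx)
      hχ hχc hχU (fun x => (hχ01 x).1) hχ1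
    have h2 : |T' (cutoffSMul χ ω hχ hχc hχU hω.smooth)| ≤ 1 * (mass N T').toReal := by
      refine abs_apply_le_mul_mass hT'.1 one_pos fun x hx τ v => ?_
      change |χ x * ω x τ v| ≤ _
      rw [abs_mul, abs_of_nonneg (hχ01 x).1]
      exact mul_le_mul (hχ01 x).2 (abs_apply_le_of_forall_le (hω.comass_le x hx) τ v)
        (abs_nonneg _) zero_le_one
    have h3 := abs_apply_le_mul_mass hT'.1 hε hβ
    have h4 := abs_apply_le_mul_mass hmass hε hβ
    change T' _ - T _ + (T' β - T β) = 0 at hRχ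
    linarith [(abs_le.1 h2).2, (abs_le.1 h3).2, (abs_le.1 h3).1, (abs_le.1 h4).1,
      (abs_le.1 h4).2]
  have hlim : Tendsto (fun ε : ℝ => (mass N T').toReal +
      ε * ((mass N T').toReal + (mass N T).toReal)) (𝓝[>] 0) (𝓝 (mass N T').toReal) := by
    have : Continuous fun ε : ℝ => (mass N T').toReal +
      ε * ((mass N T').toReal + (mass N T).toReal) := by fun_prop
    simpa using (this.tendsto 0).mono_left nhdsWithin_le_nhds
  exact ge_of_tendsto hlim (eventually_mem_nhdsWithin.mono hsmall)
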